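/- Let $G$ be a locally compact (Hausdorff) topological group and let $M(G)$ be the space of bounded real or complex Radon measures on $G$. For $\mu,\nu\in M(G)$, convolution is given by $(\mu*\nu)(B)=\int \mu(By^{-1})\,d\nu(y)$ for Borel sets $B\subseteq G$; for $p\in G$ write $\mu*p=\mu*\delta_p$, where $\delta_p$ is the point mass at $p$, so $(\mu*p)(Bp)=\mu(B)$. The relation $\mu\perp\nu$ means that $\mu,\nu$ are mutually singular. For a cardinal $\kappa$, a measure $\mu\in M(G)$ is called $\kappa$-thin if there is a set $P\subseteq G$ with $|P|=\kappa$ and $\mu*p\perp\mu*p'$ for all distinct $p,p'\in P$. Let $\chi(G)$ be the least cardinality of a neighbourhood base of the identity of $G$, and for a compact subgroup $K$ of $G$ let $\chi(G/K)$ be the least cardinality of a neighbourhood base of the point $K$ in the space $G/K$ of left cosets with the quotient topology. Let $\lambda_K$ be the normalized Haar measure of $K$, regarded as a measure on $G$. For a cardinal $\tau$ with $\aleph_0\le\tau\le\chi(G)$ let $$M_\tau(G)=\bigcup\bigl\{\{\mu\in M(G):\mu=\mu*\lambda_K\}\;:\;K\text{ a compact subgroup of }G,\ \chi(G/K)\le\tau\bigr\}.$$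 A measure $\mu\in M(G)$ is called a strongly singular measure of character $\tau$ if $\mu\in M_\tau(G)$, $\mu$ is singular to Haar measure on $G$, and, when $\tau>\aleph_0$, $\mu\perp\nu$ for every cardinal $\tau_1$ with $\aleph_0\le\tau_1<\tau$ and every $\nu\in M_{\tau_1}(G)$. **Theorem.** Let $G$ be a locally compact group, let $\tau$ be a cardinal with $\aleph_0\le\tau\le\chi(G)$, and let $\mu\in M(G)$ be a strongly singular measure of character $\tau$. Then there is a set $P\subseteq G$ with $|P|=2^\tau$ such that $\mu*p\perp\mu*p'$ for all $p,p'\in P$ with $p\ne p'$. Thus $\mu$ is $2^\tau$-thin. -/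

import Mathlib

open MeasureTheory Cardinal Topology

universe u

noncomputable section

namespace GroupMeasure

/-- The character of `X` at `x`: the least cardinality of a base of neighbourhoods of `x`. -/
def characterAt {X : Type u} [TopologicalSpace X] (x : X) : Cardinal.{u} :=
  sInf {κ | ∃ B : Set (Set X), #B = κ ∧ (𝓝 x).HasBasis (fun U => U ∈ B) id}

/-- `χ(G)`, the character of a topological group (taken at the identity). -/
def groupCharacter (G : Type u) [Group G] [TopologicalSpace G] : Cardinal.{u} :=
  characterAt (1 : G)

/-- `χ(G/K)`, the character of the space of left cosets with the quotient topology
(taken at the coset `K`). -/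
def cosetCharacter {G : Type u} [Group G] [TopologicalSpace G] (K : Subgroup G) :
    Cardinal.{u} :=
  characterAt ((1 : G) : G ⧸ K)

section Measures

variable (𝕜 : Type*) [RCLike 𝕜]
variable (G : Type u) [TopologicalSpace G] [MeasurableSpace G]

/-- `M(G)`: the bounded real (`𝕜 = ℝ`) or complex (`𝕜 = ℂ`) Radon measures on `G`, that is, the
countably additive `𝕜`-valued set functions on the σ-algebra whose total variation is a finite
regular measure (used with the Borel σ-algebra). -/
def radonMeasures : Set (VectorMeasure G 𝕜) :=
  {μ | IsFiniteMeasure μ.variation ∧ μ.variation.Regular}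

end Measures

variable {𝕜 : Type*} [RCLike 𝕜]
variable {G : Type u} [Group G] [MeasurableSpace G]

/-- `ρ` is the convolution of `μ` and `ν`: `ρ(B) = ∫ μ(B y⁻¹) dν(y)` for every Borel set `B`
(where `B y⁻¹ = {x | x * y ∈ B}`). -/
def IsConvolution (μ ν ρ : VectorMeasure G 𝕜) : Prop :=
  ∀ B : Set G, MeasurableSet B →
    ρ B = VectorMeasure.integral ν (fun y => μ ((fun x => x * y) ⁻¹' B))
      (ContinuousLinearMap.mul ℝ 𝕜)

open scoped Classical in
/-- The convolution `μ ∗ ν`. For Radon measures on a locally compact group it always exists;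
otherwise the value is `0` if it does not exist. -/
def conv (μ ν : VectorMeasure G 𝕜) : VectorMeasure G 𝕜 :=
  if h : ∃ ρ, IsConvolution μ ν ρ then h.choose else 0

theorem IsConvolution.unique {μ ν ρ ρ' : VectorMeasure G 𝕜}
    (h : IsConvolution μ ν ρ) (h' : IsConvolution μ ν ρ') : ρ = ρ' :=
  VectorMeasure.ext fun B hB => (h B hB).trans (h' B hB).symm

theorem IsConvolution.conv_eq {μ ν ρ : VectorMeasure G 𝕜} (h : IsConvolution μ ν ρ) :
    conv μ ν = ρ := by
  have hex : ∃ ρ, IsConvolution μ ν ρ := ⟨ρ, h⟩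
  rw [conv, dif_pos hex]
  exact hex.choose_spec.unique h

/-- The point mass `δ_x` in `M(G)`. -/
def pointMass (𝕜 : Type*) [RCLike 𝕜] {G : Type u} [MeasurableSpace G] (x : G) :
    VectorMeasure G 𝕜 :=
  VectorMeasure.dirac x 1

/-- `μ ∗ δ_p` is the right translate of `μ` by `p`. -/
theorem conv_pointMass [TopologicalSpace G] [IsTopologicalGroup G] [T2Space G] [BorelSpace G]
    (μ : VectorMeasure G 𝕜) (p : G) :
    conv μ (pointMass 𝕜 p) = μ.map (fun x => x * p) := by
  apply IsConvolution.conv_eq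
  intro B hB
  rw [VectorMeasure.map_apply _ (measurable_mul_const p) hB, pointMass,
    VectorMeasure.integral_dirac]
  simp

/-- `μ` is `τ`-thin: some set `P` of `τ` elements gives pairwise mutually singular right
translates `μ ∗ δ_p`. -/
def IsThin (τ : Cardinal.{u}) (μ : VectorMeasure G 𝕜) : Prop :=
  ∃ P : Set G, #P = τ ∧ ∀ p ∈ P, ∀ p' ∈ P, p ≠ p' →
    VectorMeasure.MutuallySingular (conv μ (pointMass 𝕜 p)) (conv μ (pointMass 𝕜 p'))

variable [TopologicalSpace G] [IsTopologicalGroup G] [BorelSpace G]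

/-- The normalized Haar measure `λ_K` of a compact subgroup `K`, as a positive Borel measure
on `G`. -/
def haarOfCompact (K : Subgroup G) (hK : IsCompact (K : Set G)) : Measure G :=
  haveI : CompactSpace K := isCompact_iff_compactSpace.mp hK
  (Measure.haarMeasure (⊤ : TopologicalSpace.PositiveCompacts K)).map Subtype.val

theorem isFiniteMeasure_haarOfCompact (K : Subgroup G) (hK : IsCompact (K : Set G)) :
    IsFiniteMeasure (haarOfCompact K hK) := by
  have : CompactSpace K := isCompact_iff_compactSpace.mp hK
  unfold haarOfCompact
  infer_instance

variable (𝕜)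

/-- The normalized Haar measure `λ_K` of a compact subgroup `K`, as an element of `M(G)`. -/
def haarVec (K : Subgroup G) (hK : IsCompact (K : Set G)) : VectorMeasure G 𝕜 :=
  haveI := isFiniteMeasure_haarOfCompact K hK
  (haarOfCompact K hK).toSignedMeasure.mapRange (algebraMap ℝ 𝕜).toAddMonoidHom
    (RCLike.continuous_ofReal (K := 𝕜))

/-- `M(G/K)`, identified with `M(G,K) = {μ ∈ M(G) | μ = μ ∗ λ_K}`, for a compact subgroup `K`. -/
def cosetMeasures (K : Subgroup G) (hK : IsCompact (K : Set G)) : Set (VectorMeasure G 𝕜) :=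
  {μ | μ ∈ radonMeasures 𝕜 G ∧ μ = conv μ (haarVec 𝕜 K hK)}

variable (G)

/-- `M_τ(G)`, the measures of character `τ`: the union of the spaces `M(G/K)` over all compact
subgroups `K` of `G` with `χ(G/K) ≤ τ`. -/
def measuresOfCharacter (τ : Cardinal.{u}) : Set (VectorMeasure G 𝕜) :=
  {μ | ∃ (K : Subgroup G) (hK : IsCompact (K : Set G)),
    cosetCharacter K ≤ τ ∧ μ ∈ cosetMeasures 𝕜 K hK}

/-- `M_s(G)`: the measures in `M(G)` that are singular to Haar measure. -/
def singularMeasures [LocallyCompactSpace G] : Set (VectorMeasure G 𝕜) :=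
  {μ | μ ∈ radonMeasures 𝕜 G ∧
    VectorMeasure.MutuallySingular μ (Measure.haar (G := G)).toENNRealVectorMeasure}

/-- The strongly singular measures of character `τ` (for `ℵ₀ ≤ τ ≤ χ(G)`). For `τ = ℵ₀` the last
condition is vacuous, and the set is `M_s(G) ∩ M_{ℵ₀}(G)`. -/
def stronglySingular [LocallyCompactSpace G] (τ : Cardinal.{u}) : Set (VectorMeasure G 𝕜) :=
  {μ | μ ∈ singularMeasures 𝕜 G ∧ μ ∈ measuresOfCharacter 𝕜 G τ ∧
    ∀ τ₁ : Cardinal.{u}, ℵ₀ ≤ τ₁ → τ₁ < τ → ∀ ν ∈ measuresOfCharacter 𝕜 G τ₁,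
      VectorMeasure.MutuallySingular μ ν}

end GroupMeasure

end

/-! Put `m = μ.variation`. If `p * q⁻¹` lies in every `separatingSet m n`, a Borel–Cantelli argument
gives a set carrying `m` whose translates by `p` and `q` are disjoint, so `μ * p ⊥ μ * q`
(`mutuallySingular_of_mul_inv_mem`). These sets are open, symmetric, decreasing in `n`, and miss
`1`. It remains to find `2 ^ τ` points all of whose quotients lie in every one of them.

Singularity supplies such elements through Fubini. Let `m` be carried by `A`, and let `ρ` be a
measure for which the average of `m` over `ρ`-translates vanishes on `A`. Then for `ρ`-almost every
`g` the set `A g⁻¹` carries almost none of `A`'s mass: up to shrinking `A`, `m (A g⁻¹) = 0`, and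
every such `g ≠ 1` lies in all the separating sets (`ae_mem_separatingSet`).

For `τ = ℵ₀`, take `ρ` to be Haar measure. The separating sets are dense and open in a nondiscrete
group, so a Cantor scheme yields `2 ^ ℵ₀` points.

For `τ > ℵ₀`, take `ρ = λ_K` with `K` compact of character `κ < τ`. The average `m * λ_K` is in
`M_κ(G)`, hence singular to `μ`, and `K ≠ 1` because `κ < χ(G)`; so `K` contains an element of all
the separating sets. This lets a binary tree of compact cosets be continued through all levels below
`τ`: at level `α` the subgroup has character at most `max ℵ₀ |α| < τ`. Its `2 ^ τ` branches give the
points. -/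

open scoped Pointwise

noncomputable section

namespace GroupMeasure

/-! ### Characters of compact subgroups. -/

section Characters

variable {G : Type u} [Group G] [TopologicalSpace G]

/-- `K` is the intersection of at most `κ` closed neighbourhoods of `K`. -/
def HasCharacterLE (K : Subgroup G) (κ : Cardinal.{u}) : Prop :=
  ∃ 𝒱 : Set (Set G), #𝒱 ≤ κ ∧ (∀ V ∈ 𝒱, IsClosed V ∧ V ∈ 𝓝ˢ (K : Set G)) ∧
    ⋂₀ 𝒱 = (K : Set G)

theorem characterAt_le {X : Type u} [TopologicalSpace X] {x : X} {κ : Cardinal.{u}}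
    {B : Set (Set X)} (hB : #B ≤ κ) (h : (𝓝 x).HasBasis (fun U => U ∈ B) id) :
    characterAt x ≤ κ :=
  le_trans (csInf_le' (by exact ⟨B, rfl, h⟩)) hB

theorem HasCharacterLE.mono {K : Subgroup G} {κ κ' : Cardinal.{u}} (h : HasCharacterLE K κ)
    (hκ : κ ≤ κ') : HasCharacterLE K κ' :=
  let ⟨𝒱, h₁, h₂⟩ := h
  ⟨𝒱, h₁.trans hκ, h₂⟩

theorem HasCharacterLE.iInf {ι : Type u} {K : ι → Subgroup G} {κ : Cardinal.{u}}
    (hκ : ℵ₀ ≤ κ) (hι : #ι ≤ κ) (h : ∀ i, HasCharacterLE (K i) κ) :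
    HasCharacterLE (⨅ i, K i) κ := by
  choose 𝒱 h₁ h₂ h₃ using h
  refine ⟨⋃ i, 𝒱 i, ?_, ?_, ?_⟩
  · exact (mk_iUnion_le_sum_mk.trans (sum_le_sum _ _ h₁)).trans <| by
      simpa using (mul_le_mul' hι le_rfl).trans (mul_eq_self hκ).le
  · intro V hV
    obtain ⟨i, hi⟩ := Set.mem_iUnion.1 hV
    exact ⟨(h₂ i V hi).1, nhdsSet_mono (by exact iInf_le K i) (h₂ i V hi).2⟩
  · rw [Set.sInter_iUnion, Subgroup.coe_iInf]
    exact Set.iInter_congr h₃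

theorem HasCharacterLE.inf {K L : Subgroup G} {κ : Cardinal.{u}}
    (hκ : ℵ₀ ≤ κ) (hK : HasCharacterLE K κ) (hL : HasCharacterLE L κ) :
    HasCharacterLE (K ⊓ L) κ := by
  obtain ⟨𝒱, h₁, h₂, h₃⟩ := hK
  obtain ⟨𝒲, k₁, k₂, k₃⟩ := hL
  refine ⟨𝒱 ∪ 𝒲, (mk_union_le _ _).trans ((add_le_add h₁ k₁).trans (add_eq_self hκ).le), ?_, ?_⟩
  · rintro V (hV | hV)
    · exact ⟨(h₂ V hV).1, nhdsSet_mono (by exact inf_le_left) (h₂ V hV).2⟩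
    · exact ⟨(k₂ V hV).1, nhdsSet_mono (by exact inf_le_right) (k₂ V hV).2⟩
  · rw [Set.sInter_union, h₃, k₃, Subgroup.coe_inf]

variable [LocallyCompactSpace G]

/-- Inside a compact neighbourhood `C` of `K`, finite intersections of the given closed
neighbourhoods form a base: for open `O ⊇ K`, the compact set `C \ O` misses a finite
subintersection. Thus the intersection condition, which is easy to pass to infima of subgroups,
controls the character. -/
theorem HasCharacterLE.exists_basis {K : Subgroup G} {κ : Cardinal.{u}}
    (h : HasCharacterLE K κ) (hκ : ℵ₀ ≤ κ) (hK : IsCompact (K : Set G)) :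
    ∃ B : Set (Set G), #B ≤ κ ∧ (𝓝ˢ (K : Set G)).HasBasis (fun U => U ∈ B) id := by
  obtain ⟨𝒱, h₁, h₂, h₃⟩ := h
  obtain ⟨C, hC, hKC⟩ := exists_compact_superset hK
  have hC' : C ∈ 𝓝ˢ (K : Set G) := mem_nhdsSet_iff_exists.2 ⟨_, isOpen_interior, hKC, interior_subset⟩
  refine ⟨Set.range fun F : Finset 𝒱 => C ∩ ⋂ V ∈ F, (V : Set G), ?_, ⟨fun U => ⟨fun hU => ?_, ?_⟩⟩⟩
  · refine mk_range_le.trans ?_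
    rcases finite_or_infinite 𝒱 with hfin | hinf
    · exact (mk_le_aleph0 (α := Finset 𝒱)).trans hκ
    · rwa [mk_finset_of_infinite]
  · obtain ⟨O, hO, hKO, hOU⟩ := mem_nhdsSet_iff_exists.1 hU
    obtain ⟨F, hF⟩ := (hC.diff hO).elim_finite_subfamily_closed
      (fun V : 𝒱 => (V : Set G)) (fun V => (h₂ V V.2).1) (by
        rw [← Set.sInter_eq_iInter, h₃]
        exact Set.eq_empty_of_forall_notMem fun x hx => hx.1.2 (hKO hx.2))
    refine ⟨_, ⟨F, rfl⟩, fun x hx => hOU ?_⟩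
    by_contra hxO
    exact Set.notMem_empty x (hF ▸ ⟨⟨hx.1, hxO⟩, hx.2⟩)
  · rintro ⟨_, ⟨F, rfl⟩, hFU⟩
    refine Filter.mem_of_superset (Filter.inter_mem hC' ?_) hFU
    exact (Filter.biInter_finset_mem F).2 fun V _ => (h₂ V V.2).2

theorem HasCharacterLE.groupCharacter_le {κ : Cardinal.{u}}
    (h : HasCharacterLE (⊥ : Subgroup G) κ) (hκ : ℵ₀ ≤ κ) : groupCharacter G ≤ κ := by
  obtain ⟨B, hB, hb⟩ := h.exists_basis hκ (by simp)
  exact characterAt_le hB (by simpa using hb)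

variable [IsTopologicalGroup G]

theorem HasCharacterLE.cosetCharacter_le {K : Subgroup G} {κ : Cardinal.{u}}
    (h : HasCharacterLE K κ) (hκ : ℵ₀ ≤ κ) (hK : IsCompact (K : Set G)) :
    cosetCharacter K ≤ κ := by
  obtain ⟨B, hB, hb⟩ := h.exists_basis hκ hK
  refine characterAt_le (B := (fun W => ((↑) : G → G ⧸ K) '' W) '' B) (mk_image_le.trans hB) ⟨fun U => ?_⟩
  constructor
  · intro hU
    obtain ⟨O, hOU, hO, h1O⟩ := mem_nhds_iff.1 hU
    obtain ⟨W, hW, hWO⟩ := hb.mem_iff.1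
      ((hO.preimage QuotientGroup.continuous_mk).mem_nhdsSet.2 fun k (hk : k ∈ K) => by
        have : (k : G ⧸ K) = (1 : G) := QuotientGroup.eq.2 (by simpa using hk)
        simpa [this] using h1O)
    exact ⟨_, ⟨W, hW, rfl⟩, (Set.image_subset_iff.2 hWO).trans hOU⟩
  · rintro ⟨_, ⟨W, hW, rfl⟩, hWU⟩
    refine Filter.mem_of_superset ?_ hWU
    exact QuotientGroup.isOpenMap_coe.image_mem_nhds
      (nhds_le_nhdsSet (one_mem K : (1 : G) ∈ (K : Set G)) (hb.mem_of_mem hW))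

/-- The Kakutani–Kodaira construction: symmetric closed `V n` with `V (n + 1) * V (n + 1) ⊆ V n ∩ U
n` intersect in a subgroup. -/
theorem exists_compact_subgroup_subset (U : ℕ → Set G) (hU : ∀ n, U n ∈ 𝓝 (1 : G)) :
    ∃ L : Subgroup G, IsCompact (L : Set G) ∧ HasCharacterLE L ℵ₀ ∧ ∀ n, (L : Set G) ⊆ U n := by
  obtain ⟨C, hC, hC1⟩ := exists_compact_mem_nhds (1 : G)
  have step : ∀ A ∈ 𝓝 (1 : G), ∃ V ∈ 𝓝 (1 : G), IsClosed V ∧ V⁻¹ = V ∧ V * V ⊆ A :=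
    fun A hA => exists_closed_nhds_one_inv_eq_mul_subset hA
  choose! f hf1 hfc hfi hfm using step
  -- Starting from `f C` forces the intersection into the compact set `C`.
  let V : ℕ → Set G := fun n => Nat.rec (f C) (fun n A => f (A ∩ U n)) n
  have hV0 : V 0 = f C := rfl
  have hVs : ∀ n, V (n + 1) = f (V n ∩ U n) := fun n => rfl
  have hV1 : ∀ n, V n ∈ 𝓝 (1 : G) := by
    intro n
    induction n with
    | zero => exact hf1 _ hC1
    | succ n ih => exact hf1 _ (Filter.inter_mem ih (hU n))
  have hVc : ∀ n, IsClosed (V n) := by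
    rintro (_ | n)
    · exact hfc _ hC1
    · exact hfc _ (Filter.inter_mem (hV1 n) (hU n))
  have hVi : ∀ n, (V n)⁻¹ = V n := by
    rintro (_ | n)
    · exact hfi _ hC1
    · exact hfi _ (Filter.inter_mem (hV1 n) (hU n))
  have hVm : ∀ n, V (n + 1) * V (n + 1) ⊆ V n ∩ U n := fun n =>
    hfm _ (Filter.inter_mem (hV1 n) (hU n))
  let L : Subgroup G :=
    { carrier := ⋂ n, V n
      mul_mem' := fun {a b} ha hb => Set.mem_iInter.2 fun n =>
        (hVm n (Set.mul_mem_mul (Set.mem_iInter.1 ha (n + 1)) (Set.mem_iInter.1 hb (n + 1)))).1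
      one_mem' := Set.mem_iInter.2 fun n => mem_of_mem_nhds (hV1 n)
      inv_mem' := fun {a} ha => Set.mem_iInter.2 fun n => by
        rw [← hVi n]; simpa using Set.mem_iInter.1 ha n }
  have hLV : ∀ n, (L : Set G) ⊆ V n := fun n => Set.iInter_subset _ n
  have hLcl : IsClosed (L : Set G) := isClosed_iInter hVc
  have hLC : (L : Set G) ⊆ C := fun x hx => hfm C hC1
    ⟨x, hLV 0 hx, 1, mem_of_mem_nhds (hV1 0), mul_one x⟩
  refine ⟨L, hC.of_isClosed_subset hLcl hLC, ⟨Set.range V, ?_, ?_, ?_⟩, fun n x hx => ?_⟩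
  · exact mk_le_aleph0_iff.2 (Set.countable_range V).to_subtype
  · rintro _ ⟨n, rfl⟩
    refine ⟨hVc n, mem_nhdsSet_iff_forall.2 fun x hx => ?_⟩
    have : x • V (n + 1) ∈ 𝓝 x := by
      simpa using smul_mem_nhds_smul x (hV1 (n + 1))
    refine Filter.mem_of_superset this ?_
    rintro _ ⟨y, hy, rfl⟩
    exact (hVm n (Set.mul_mem_mul (hLV (n + 1) hx) hy)).1
  · exact Set.sInter_range V
  · exact (hVm n ⟨x, hLV (n + 1) hx, 1, mem_of_mem_nhds (hV1 (n + 1)), mul_one x⟩).2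

end Characters


/-! ### The transfinite tree of cosets, for uncountable `τ`. -/

section Tree

variable {G : Type u} [Group G] [TopologicalSpace G]

/-- The right coset `K p` given by the pair `(p, K)`. -/
def rightCoset (s : G × Subgroup G) : Set G := {g | g * s.1⁻¹ ∈ s.2}

open scoped Classical in
/-- A right coset contained in `K₀` and in all cosets of the family, if there is one. -/
def limitCoset (K₀ : Subgroup G) {J : Type u} (F : J → G × Subgroup G) : G × Subgroup G :=
  (if h : ((K₀ : Set G) ∩ ⋂ j, rightCoset (F j)).Nonempty then h.choose else 1,
    K₀ ⊓ ⨅ j, (F j).2)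

variable [IsTopologicalGroup G]

theorem isCompact_rightCoset {s : G × Subgroup G} (h : IsCompact (s.2 : Set G)) :
    IsCompact (rightCoset s) :=
  (Homeomorph.mulRight s.1⁻¹).isCompact_preimage.2 h

/-- Nested compact cosets meet. The intersection with `K₀` covers the empty family, that is, the
root of the tree. -/
theorem limitCoset_fst_mem [T2Space G] {K₀ : Subgroup G} {J : Type u} [LinearOrder J]
    {F : J → G × Subgroup G} (hc : ∀ j, IsCompact ((F j).2 : Set G))
    (h₀ : ∀ j, rightCoset (F j) ⊆ K₀)
    (hF : ∀ i j, i < j → rightCoset (F j) ⊆ rightCoset (F i)) :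
    (limitCoset K₀ F).1 ∈ K₀ ∧ ∀ j, (limitCoset K₀ F).1 ∈ rightCoset (F j) := by
  have hne : ((K₀ : Set G) ∩ ⋂ j, rightCoset (F j)).Nonempty := by
    rcases isEmpty_or_nonempty J with hJ | ⟨⟨j₀⟩⟩
    · exact ⟨1, one_mem K₀, by simp⟩
    · have : Nonempty J := ⟨j₀⟩
      have anti : Antitone fun j => rightCoset (F j) := fun i j hij => by
        rcases hij.eq_or_lt with rfl | h
        exacts [le_rfl, hF _ _ h]
      obtain ⟨g, hg⟩ := IsCompact.nonempty_iInter_of_directed_nonempty_isCompact_isClosed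
        (fun j => rightCoset (F j)) anti.directed_ge
        (fun j => ⟨(F j).1, by simp [rightCoset]⟩) (fun j => isCompact_rightCoset (hc j))
        (fun j => (isCompact_rightCoset (hc j)).isClosed)
      exact ⟨g, h₀ j₀ (Set.mem_iInter.1 hg j₀), hg⟩
  have hs := hne.choose_spec
  rw [limitCoset, dif_pos hne]
  exact ⟨hs.1, Set.mem_iInter.1 hs.2⟩

/-- By continuity of `(a, b) ↦ a * k * b⁻¹` at `(1, 1)`, each `U n` allows a neighbourhood of `1`.
Countably many neighbourhoods contain a compact subgroup of countable character, and intersecting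
`K` with it does not raise an infinite character bound. -/
theorem exists_subgroup_separating [LocallyCompactSpace G] [T2Space G] {K : Subgroup G}
    (hK : IsCompact (K : Set G)) {U : ℕ → Set G} (hUo : ∀ n, IsOpen (U n)) {k : G}
    (hk : ∀ n, k ∈ U n) :
    ∃ L ≤ K, IsCompact (L : Set G) ∧
      (∀ κ, ℵ₀ ≤ κ → HasCharacterLE K κ → HasCharacterLE L κ) ∧
      ∀ l ∈ L, ∀ l' ∈ L, ∀ n, l * k * l'⁻¹ ∈ U n := by
  have hW : ∀ n, ∃ W ∈ 𝓝 (1 : G), ∀ a ∈ W, ∀ b ∈ W, a * k * b⁻¹ ∈ U n := fun n => by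
    have hc : Filter.Tendsto (fun q : G × G => q.1 * k * q.2⁻¹) (𝓝 1 ×ˢ 𝓝 1) (𝓝 k) := by
      rw [← nhds_prod_eq]
      have : Continuous fun q : G × G => q.1 * k * q.2⁻¹ := by fun_prop
      simpa using this.tendsto (1, 1)
    obtain ⟨W, hW, hWU⟩ := Filter.mem_prod_same_iff.1 (hc ((hUo n).mem_nhds (hk n)))
    exact ⟨W, hW, fun a ha b hb => hWU (Set.mk_mem_prod ha hb)⟩
  choose W hW hWU using hW
  obtain ⟨L, hL, hLc, hLW⟩ := exists_compact_subgroup_subset W hW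
  refine ⟨K ⊓ L, inf_le_left, ?_, fun κ hκ h => h.inf hκ (hLc.mono hκ),
    fun l hl l' hl' n => hWU n _ (hLW n hl.2) _ (hLW n hl'.2)⟩
  rw [Subgroup.coe_inf]
  exact hK.inter hL

theorem exists_separated_tree [LocallyCompactSpace G] [T2Space G] {τ : Cardinal.{u}}
    (hτ : ℵ₀ < τ) {U : ℕ → Set G} (hUo : ∀ n, IsOpen (U n)) (hUi : ∀ n, (U n)⁻¹ = U n)
    (H : ∀ K : Subgroup G, IsCompact (K : Set G) → ∀ κ, ℵ₀ ≤ κ → κ < τ → HasCharacterLE K κ →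
      ∃ k ∈ K, ∀ n, k ∈ U n) :
    ∃ p : (τ.ord.ToType → Bool) → G, ∀ x y, x ≠ y → ∀ n, p x * (p y)⁻¹ ∈ U n := by
  -- The root only has to be some compact subgroup of countable character.
  obtain ⟨K₀, hK₀, hK₀c, -⟩ :=
    exists_compact_subgroup_subset (fun _ => (Set.univ : Set G)) fun _ => Filter.univ_mem
  have step : ∀ K : Subgroup G,
      (IsCompact (K : Set G) ∧ ∃ κ, ℵ₀ ≤ κ ∧ κ < τ ∧ HasCharacterLE K κ) →
      ∃ (k : G) (L : Subgroup G), k ∈ K ∧ L ≤ K ∧ IsCompact (L : Set G) ∧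
        (∀ κ, ℵ₀ ≤ κ → HasCharacterLE K κ → HasCharacterLE L κ) ∧
        ∀ l ∈ L, ∀ l' ∈ L, ∀ n, l * k * l'⁻¹ ∈ U n := by
    rintro K ⟨hK, κ, h₁, h₂, h₃⟩
    obtain ⟨k, hk, hkU⟩ := H K hK κ h₁ h₂ h₃
    obtain ⟨L, hL⟩ := exists_subgroup_separating hK hUo hkU
    exact ⟨k, L, hk, hL⟩
  choose! k L hkK hLK hLc hLκ hLU using step
  -- The coset `K s` splits into the subcosets `L k s` and `L s`; quotients of their elements have
  -- the form `l * k * l'⁻¹`, which lies in every `U n`.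
  let next : G × Subgroup G → Bool → G × Subgroup G := fun s b =>
    (if b then k s.2 * s.1 else s.1, L s.2)
  let st : (τ.ord.ToType → Bool) → τ.ord.ToType → G × Subgroup G := fun x =>
    IsWellFounded.fix (· < ·) fun α ih => limitCoset K₀ fun β : Set.Iio α => next (ih β β.2) (x β)
  have st_eq : ∀ x α, st x α = limitCoset K₀ fun β : Set.Iio α => next (st x β) (x β) :=
    fun x α => IsWellFounded.fix_eq _ _ _
  have st_congr : ∀ x y α, (∀ β < α, x β = y β) → st x α = st y α := by
    intro x y α
    induction α using WellFoundedLT.induction with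
    | ind α ih =>
      intro h
      rw [st_eq, st_eq]
      congr 1
      funext β
      rw [ih β β.2 fun γ hγ => h γ (hγ.trans β.2), h β β.2]
  -- The invariant of the recursion; the bound `max ℵ₀ #(Set.Iio α)`, which is below `τ`, is what
  -- makes `H` applicable at every level.
  let Good : (τ.ord.ToType → Bool) → τ.ord.ToType → Prop := fun x α =>
    (IsCompact ((st x α).2 : Set G) ∧ HasCharacterLE (st x α).2 (max ℵ₀ #(Set.Iio α))) ∧
      (st x α).1 ∈ K₀ ∧ ∀ β < α, (st x α).1 ∈ rightCoset (next (st x β) (x β))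
  have card_lt : ∀ α : τ.ord.ToType, max ℵ₀ #(Set.Iio α) < τ := fun α =>
    max_lt hτ ((mk_Iio_lt α (by simp)).trans_eq (mk_ord_toType τ))
  have hst : ∀ {x α}, Good x α → IsCompact ((st x α).2 : Set G) ∧
      ∃ κ, ℵ₀ ≤ κ ∧ κ < τ ∧ HasCharacterLE (st x α).2 κ := fun h =>
    ⟨h.1.1, _, le_max_left _ _, card_lt _, h.1.2⟩
  have le_K₀ : ∀ x α, (st x α).2 ≤ K₀ := fun x α => by
    rw [st_eq]; exact inf_le_left
  have le_next : ∀ x α β, β < α → (st x α).2 ≤ L (st x β).2 := fun x α β h => by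
    rw [st_eq x α]; exact inf_le_right.trans (iInf_le _ (⟨β, h⟩ : Set.Iio α))
  have next_subset : ∀ {x α}, Good x α →
      rightCoset (next (st x α) (x α)) ⊆ rightCoset (st x α) := by
    intro x α h g hg
    have h₁ : g * (next (st x α) (x α)).1⁻¹ ∈ (st x α).2 := hLK _ (hst h) hg
    have h₂ : (next (st x α) (x α)).1 * (st x α).1⁻¹ ∈ (st x α).2 := by
      cases hb : x α <;> simp [next, hkK _ (hst h)]
    simpa [rightCoset] using mul_mem h₁ h₂
  have subset_next : ∀ {x α}, Good x α → ∀ β < α,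
      rightCoset (st x α) ⊆ rightCoset (next (st x β) (x β)) := by
    intro x α h β hβ g hg
    have h₁ : g * (st x α).1⁻¹ ∈ L (st x β).2 := le_next x α β hβ hg
    have h₂ := mul_mem h₁ (h.2.2 β hβ)
    simpa [rightCoset, mul_assoc] using h₂
  have subset_K₀ : ∀ {x α}, Good x α → rightCoset (st x α) ⊆ K₀ := by
    intro x α h g hg
    have := mul_mem (le_K₀ x α hg) h.2.1
    simpa using this
  have hgood : ∀ x α, Good x α := by
    intro x α
    induction α using WellFoundedLT.induction with
    | ind α ih =>
      have hmem := limitCoset_fst_mem (K₀ := K₀) (F := fun β : Set.Iio α => next (st x β) (x β))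
        (fun β => hLc _ (hst (ih β β.2)))
        (fun β => (next_subset (ih β β.2)).trans (subset_K₀ (ih β β.2)))
        (fun β γ hβγ => (next_subset (ih γ γ.2)).trans (subset_next (ih γ γ.2) β hβγ))
      rw [← st_eq] at hmem
      refine ⟨⟨?_, ?_⟩, hmem.1, fun β hβ => hmem.2 ⟨β, hβ⟩⟩
      · refine hK₀.of_isClosed_subset ?_ (le_K₀ x α)
        rw [st_eq]
        simp only [limitCoset, Subgroup.coe_inf, Subgroup.coe_iInf]
        exact hK₀.isClosed.inter (isClosed_iInter fun β => (hLc _ (hst (ih β β.2))).isClosed)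
      · rw [st_eq]
        refine (hK₀c.mono (le_max_left _ _)).inf (le_max_left _ _)
          (HasCharacterLE.iInf (le_max_left _ _) (le_max_right _ _) fun β => ?_)
        refine hLκ _ (hst (ih β β.2)) _ (le_max_left _ _) ((ih β β.2).1.2.mono ?_)
        exact max_le_max le_rfl (mk_le_mk_of_subset (Set.Iio_subset_Iio (le_of_lt β.2)))
  let p : (τ.ord.ToType → Bool) → G := fun x =>
    (limitCoset K₀ fun α : τ.ord.ToType => next (st x α) (x α)).1
  have hp : ∀ x α, p x ∈ rightCoset (next (st x α) (x α)) := fun x =>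
    (limitCoset_fst_mem (fun α => hLc _ (hst (hgood x α)))
      (fun α => (next_subset (hgood x α)).trans (subset_K₀ (hgood x α)))
      (fun β γ hβγ => (next_subset (hgood x γ)).trans (subset_next (hgood x γ) β hβγ))).2
  have key : ∀ x y α, (∀ β < α, x β = y β) → x α = true → y α = false →
      ∀ n, p x * (p y)⁻¹ ∈ U n := by
    intro x y α hlt hx hy n
    have h₁ := hp x α
    have h₂ := hp y α
    rw [← st_congr x y α hlt] at h₂
    have := hLU _ (hst (hgood x α)) _ h₁ _ h₂ n
    simpa [next, hx, hy, mul_assoc] using this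
  refine ⟨p, fun x y hxy n => ?_⟩
  -- At the first disagreement both branches share the node `st x α` and leave it by different
  -- children; symmetry of `U n` takes care of the order.
  obtain ⟨α, hα, hmin⟩ := WellFounded.has_min (r := ((· < ·) : τ.ord.ToType → _ → Prop))
    wellFounded_lt {α | x α ≠ y α} (Function.ne_iff.1 hxy)
  have hlt : ∀ β < α, x β = y β := fun β hβ => by
    by_contra h
    exact hmin β h hβ
  cases hx : x α
  · have hy : y α = true := by
      cases hy : y α
      · exact absurd (hx.trans hy.symm) hα
      · rfl
    have := key y x α (fun β hβ => (hlt β hβ).symm) hy hx n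
    rw [← hUi n]
    simpa using this
  · have hy : y α = false := by
      cases hy : y α
      · rfl
      · exact absurd (hx.trans hy.symm) hα
    exact key x y α hlt hx hy n

end Tree


/-! ### The Cantor scheme, for `τ = ℵ₀`. -/

section Scheme

variable {G : Type u} [Group G] [TopologicalSpace G] [IsTopologicalGroup G]
  [LocallyCompactSpace G]

/-- In the product `T → G`, the condition that two given distinct coordinates have quotient in `U`
is open and dense. A tuple satisfying all of these conditions exists in the box of the `V (f t)`,
and so does a small box around it. -/
theorem exists_separated_refinement {S T : Type} [Finite T] (f : T → S) {V : S → Set G}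
    (hVo : ∀ s, IsOpen (V s)) (hVn : ∀ s, (V s).Nonempty) {U : Set G} (hU : IsOpen U)
    (hUd : Dense U) :
    ∃ W : T → Set G, (∀ t, IsOpen (W t)) ∧ (∀ t, (W t).Nonempty) ∧
      (∀ t, IsCompact (closure (W t))) ∧ (∀ t, closure (W t) ⊆ V (f t)) ∧
      ∀ t t', t ≠ t' → ∀ a ∈ W t, ∀ b ∈ W t', a * b⁻¹ ∈ U := by
  classical
  let D : {q : T × T // q.1 ≠ q.2} → Set (T → G) := fun q => {g | g q.1.1 * (g q.1.2)⁻¹ ∈ U}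
  have hDo : ∀ q, IsOpen (D q) := fun q => hU.preimage (by fun_prop)
  have hDd : ∀ q, Dense (D q) := by
    rintro ⟨⟨t, t'⟩, htt'⟩
    refine dense_iff_inter_open.2 fun O hO ⟨g, hg⟩ => ?_
    -- Density is tested by moving the single coordinate `t`, so that its quotient by coordinate
    -- `t'` becomes `a`.
    have hcont : Continuous fun a : G => Function.update g t (a * g t') := by fun_prop
    obtain ⟨a, haO, haU⟩ := hUd.inter_open_nonempty _ (hO.preimage hcont)
      ⟨g t * (g t')⁻¹, by simpa using hg⟩
    refine ⟨_, haO, ?_⟩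
    have : t' ≠ t := fun h => htt' h.symm
    simpa [D, this] using haU
  have hopen : IsOpen (⋂ q, D q) := isOpen_iInter_of_finite hDo
  obtain ⟨g, hgV, hgD⟩ := (dense_iInter_of_isOpen hDo hDd).inter_open_nonempty
    (Set.univ.pi fun t => V (f t)) (isOpen_set_pi Set.finite_univ fun t _ => hVo _)
    (Set.univ_pi_nonempty_iff.2 fun t => hVn _)
  obtain ⟨O, hO, hOD⟩ := isOpen_pi_iff'.1 hopen g hgD
  have hW : ∀ t, ∃ W : Set G, IsOpen W ∧ g t ∈ W ∧ IsCompact (closure W) ∧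
      closure W ⊆ O t ∩ V (f t) := fun t => by
    obtain ⟨W, h₁, h₂, h₃, h₄⟩ := exists_open_between_and_isCompact_closure
      (isCompact_singleton (x := g t)) ((hO t).1.inter (hVo (f t)))
      (Set.singleton_subset_iff.2 ⟨(hO t).2, hgV t trivial⟩)
    exact ⟨W, h₁, h₂ rfl, h₄, h₃⟩
  choose W hWo hgW hWc hWO using hW
  refine ⟨W, hWo, fun t => ⟨_, hgW t⟩, hWc, fun t => (hWO t).trans Set.inter_subset_right, ?_⟩
  intro t t' htt' a ha b hb
  have hmem : Function.update (Function.update g t a) t' b ∈ Set.univ.pi O := by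
    intro i _
    by_cases h' : i = t'
    · subst h'
      simpa using (hWO _ (subset_closure hb)).1
    · by_cases h : i = t
      · subst h
        simpa [h'] using (hWO _ (subset_closure ha)).1
      · simpa [h, h'] using (hO i).2
  have := Set.mem_iInter.1 (hOD hmem) ⟨(t, t'), htt'⟩
  simpa [D, htt'] using this

theorem exists_separated_scheme {U : ℕ → Set G} (hUo : ∀ n, IsOpen (U n))
    (hUd : ∀ n, Dense (U n)) (hU : Antitone U) :
    ∃ p : (ℕ → Bool) → G, ∀ x y, x ≠ y → ∀ n, p x * (p y)⁻¹ ∈ U n := by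
  let Node : ℕ → Type u := fun n =>
    {V : (Fin n → Bool) → Set G // (∀ s, IsOpen (V s)) ∧ ∀ s, (V s).Nonempty}
  have step : ∀ n (V : Node n), ∃ W : Node (n + 1), (∀ t, IsCompact (closure (W.1 t))) ∧
      (∀ t, closure (W.1 t) ⊆ V.1 (Fin.init t)) ∧
      ∀ t t', t ≠ t' → ∀ a ∈ W.1 t, ∀ b ∈ W.1 t', a * b⁻¹ ∈ U n := fun n V => by
    obtain ⟨W, h₁, h₂, h₃⟩ := exists_separated_refinement
      (fun t : Fin (n + 1) → Bool => (Fin.init t : Fin n → Bool)) V.2.1 V.2.2 (hUo n) (hUd n)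
    exact ⟨⟨W, h₁, h₂⟩, h₃⟩
  choose next hnc hns hnU using step
  let V : ∀ n, Node n := fun n =>
    Nat.rec ⟨fun _ => Set.univ, fun _ => isOpen_univ, fun _ => Set.univ_nonempty⟩ next n
  let A : (ℕ → Bool) → ℕ → Set G := fun x n => closure ((V (n + 1)).1 fun i => x i)
  have hAV : ∀ x n, A x n ⊆ (V n).1 fun i => x i := fun x n => hns n (V n) _
  have hA : ∀ x, (⋂ n, A x n).Nonempty := fun x =>
    IsCompact.nonempty_iInter_of_sequence_nonempty_isCompact_isClosed (A x)
      (fun n => (hAV x (n + 1)).trans subset_closure)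
      (fun n => ((V (n + 1)).2.2 _).mono subset_closure) (hnc 0 (V 0) _)
      (fun n => isClosed_closure)
  choose p hp using hA
  refine ⟨p, fun x y hxy n => ?_⟩
  obtain ⟨i, hi⟩ := Function.ne_iff.1 hxy
  have hpV : ∀ x n, p x ∈ (V (n + 1)).1 fun i => x i := fun x n =>
    hAV x (n + 1) (Set.mem_iInter.1 (hp x) (n + 1))
  -- Level `max n i` already sees the disagreement at `i`, and its separation in `U (max n i)`
  -- implies that in `U n`.
  refine hU (le_max_left n i) (hnU _ (V (max n i)) _ _ (fun h => hi ?_) _ (hpV x _) _ (hpV y _))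
  exact congr_fun h ⟨i, Nat.lt_succ_of_le (le_max_right n i)⟩

end Scheme


/-! ### Compact supports for Fubini. -/

section Support

variable {G : Type u} [Group G] [TopologicalSpace G] [IsTopologicalGroup G]

theorem hasCompactSupport_mul_translate {f h : G → ℝ} (hf : HasCompactSupport f)
    (hh : HasCompactSupport h) :
    HasCompactSupport (Function.uncurry fun x g => f (x * g) * h g) := by
  have hcomp : IsCompact ((tsupport f * (tsupport h)⁻¹) ×ˢ tsupport h) :=
    (IsCompact.mul hf (IsCompact.inv hh)).prod hh
  refine HasCompactSupport.intro hcomp ?_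
  rintro ⟨x, g⟩ hxg
  by_contra hne
  have hfx : x * g ∈ tsupport f := subset_tsupport _ (left_ne_zero_of_mul hne)
  have hhg : g ∈ tsupport h := subset_tsupport _ (right_ne_zero_of_mul hne)
  exact hxg ⟨⟨x * g, hfx, g⁻¹, Set.inv_mem_inv.2 hhg, mul_inv_cancel_right x g⟩, hhg⟩

end Support

/-! ### Separating sets and the Fubini argument. -/

section Separation

variable {G : Type u} [Group G] [TopologicalSpace G] [MeasurableSpace G]

/-- The elements `g ≠ 1` such that `C ∩ C g = ∅` for some compact set `C` that carries `m` up to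
`1 / (n + 1)`. -/
def separatingSet (m : Measure G) (n : ℕ) : Set G :=
  {g | g ≠ 1 ∧ ∃ C, IsCompact C ∧ m Cᶜ < ((n : ENNReal) + 1)⁻¹ ∧ g ∉ C⁻¹ * C}

theorem separatingSet_antitone (m : Measure G) : Antitone (separatingSet m) := by
  rintro i j hij g ⟨h₁, C, hC, hm, hg⟩
  refine ⟨h₁, C, hC, hm.trans_le ?_, hg⟩
  gcongr

theorem inv_separatingSet (m : Measure G) (n : ℕ) : (separatingSet m n)⁻¹ = separatingSet m n := by
  suffices h : ∀ g ∈ separatingSet m n, g⁻¹ ∈ separatingSet m n by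
    ext g
    exact ⟨fun hg => by simpa using h _ hg, h g⟩
  rintro g ⟨h₁, C, hC, hm, hg⟩
  refine ⟨inv_ne_one.2 h₁, C, hC, hm, fun h => hg ?_⟩
  rw [← Set.inv_mem_inv] at h
  simpa using h

theorem exists_disjoint_translates_of_mem_separatingSet {m : Measure G} {p q : G}
    (h : ∀ n, p * q⁻¹ ∈ separatingSet m n) :
    ∃ A, MeasurableSet A ∧ m Aᶜ = 0 ∧ ∀ a ∈ A, ∀ b ∈ A, a * p ≠ b * q := by
  choose h₁ C hC hm hg using h
  -- Along the indices `2 ^ n` the bounds `1 / (2 ^ n + 1)` are summable, so almost every point lies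
  -- in all but finitely many `C (2 ^ n)`.
  have hA : m {x | ∃ᶠ n in Filter.atTop, x ∈ (C (2 ^ n))ᶜ} = 0 := by
    refine measure_setOfPred_frequently_eq_zero (ne_top_of_le_ne_top ?_
      (ENNReal.tsum_le_tsum (g := fun n : ℕ => (2⁻¹ : ENNReal) ^ n) fun n => (hm (2 ^ n)).le.trans ?_))
    · rw [ENNReal.tsum_geometric_two]; simp
    · rw [← ENNReal.inv_pow]
      push_cast
      gcongr
      exact le_self_add
  refine ⟨(toMeasurable m {x | ∃ᶠ n in Filter.atTop, x ∈ (C (2 ^ n))ᶜ})ᶜ,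
    (measurableSet_toMeasurable _ _).compl, by simpa using hA, ?_⟩
  have key : ∀ a ∉ toMeasurable m {x | ∃ᶠ n in Filter.atTop, x ∈ (C (2 ^ n))ᶜ},
      ∀ᶠ n in Filter.atTop, a ∈ C (2 ^ n) := fun a ha => by
    have := mt (fun h => subset_toMeasurable m _ h) ha
    simpa using this
  intro a ha b hb hab
  obtain ⟨n, han, hbn⟩ := ((key a ha).and (key b hb)).exists
  refine hg (2 ^ n) ⟨a⁻¹, Set.inv_mem_inv.2 han, b, hbn, ?_⟩
  show a⁻¹ * b = p * q⁻¹
  rw [inv_mul_eq_iff_eq_mul, ← mul_assoc, hab, mul_inv_cancel_right]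

variable [IsTopologicalGroup G]

theorem continuous_integral_mul_translate [BorelSpace G] {m : Measure G} [IsFiniteMeasureOnCompacts m]
    {f h : G → ℝ} (hf : Continuous f) (hfc : HasCompactSupport f) (hh : Continuous h)
    (hhc : HasCompactSupport h) : Continuous fun g => ∫ x, f (x * g) * h g ∂m := by
  rw [← continuousOn_univ]
  refine continuousOn_integral_of_compact_support (k := tsupport f * (tsupport h)⁻¹)
    (IsCompact.mul hfc (IsCompact.inv hhc)) (Continuous.continuousOn (by
      simp only [Function.uncurry_def]; fun_prop)) fun g x _ hx => ?_
  by_contra hne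
  exact hx ⟨x * g, subset_tsupport _ (left_ne_zero_of_mul hne), g⁻¹,
    Set.inv_mem_inv.2 (subset_tsupport _ (right_ne_zero_of_mul hne)), mul_inv_cancel_right x g⟩

theorem exists_bump_integral_lt [LocallyCompactSpace G] [BorelSpace G] {ν : Measure G} [ν.Regular] {C : Set G} (hC : IsCompact C)
    (hν : ν C = 0) {ε : ℝ} (hε : 0 < ε) :
    ∃ f : C(G, ℝ), HasCompactSupport f ∧ (∀ x, f x ∈ Set.Icc (0 : ℝ) 1) ∧ (∀ x ∈ C, f x = 1) ∧
      ∫ x, f x ∂ν < ε := by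
  obtain ⟨V, hCV, hV, hνV⟩ := C.exists_isOpen_lt_of_lt (μ := ν) (ENNReal.ofReal ε) (by simpa [hν])
  obtain ⟨f, hf1, hf0, hfc, hf⟩ := exists_continuous_one_zero_of_isCompact hC hV.isClosed_compl
    (Set.disjoint_compl_right_iff_subset.2 hCV)
  refine ⟨f, hfc, hf, fun x hx => hf1 hx, ?_⟩
  rw [integral_eq_lintegral_of_nonneg_ae (Filter.Eventually.of_forall fun x => (hf x).1)
    f.continuous.aestronglyMeasurable, ← ENNReal.lt_ofReal_iff_toReal_lt]
  · refine lt_of_le_of_lt ?_ hνV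
    rw [← lintegral_indicator_one hV.measurableSet]
    refine lintegral_mono fun x => ?_
    by_cases hx : x ∈ V
    · simpa [hx] using (hf x).2
    · simp [hx, hf0 (show x ∈ Vᶜ from hx)]
  · have := (f.continuous.integrable_of_hasCompactSupport hfc (μ := ν)).lintegral_lt_top
    exact this.ne

/-- With `F n g = ∫ f n (x * g) * h g dm(x)`, Fubini makes the `ρ`-integrals of `F n` tend to `0`,
while `F n g ≥ h g * m (C g⁻¹)`. The cutoff `h` makes the integrand compactly supported, so Fubini
needs no σ-finiteness of `ρ`. -/
theorem ae_measure_translate_eq_zero [BorelSpace G] {m ρ : Measure G} [IsFiniteMeasure m]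
    [IsFiniteMeasureOnCompacts ρ] {h : G → ℝ} (hh : Continuous h) (hhc : HasCompactSupport h)
    (hh0 : ∀ g, 0 ≤ h g) {C : Set G}
    (H : ∀ ε > 0, ∃ f : G → ℝ, Continuous f ∧ HasCompactSupport f ∧ (∀ x, 0 ≤ f x) ∧
      (∀ x ∈ C, 1 ≤ f x) ∧ ∫ x, ∫ g, f (x * g) * h g ∂ρ ∂m < ε) :
    ∀ᵐ g ∂ρ, h g = 0 ∨ m {x | x * g ∈ C} = 0 := by
  choose f hf hfc hf0 hf1 hfε using fun n : ℕ => H (1 / ((n : ℝ) + 1)) Nat.one_div_pos_of_nat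
  let F : ℕ → G → ℝ := fun n g => ∫ x, f n (x * g) * h g ∂m
  have hFc : ∀ n, Continuous (F n) := fun n =>
    continuous_integral_mul_translate (hf n) (hfc n) hh hhc
  have hF0 : ∀ n g, 0 ≤ F n g := fun n g =>
    integral_nonneg fun x => mul_nonneg (hf0 n _) (hh0 g)
  have hFs : ∀ n, HasCompactSupport (F n) := fun n => hhc.mono fun g hg hne => hg (by simp [F, hne])
  have hFint : ∀ n, ∫⁻ g, ENNReal.ofReal (F n g) ∂ρ ≤ ENNReal.ofReal (1 / ((n : ℝ) + 1)) := fun n => by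
    rw [← ofReal_integral_eq_lintegral_ofReal ((hFc n).integrable_of_hasCompactSupport (hFs n))
      (Filter.Eventually.of_forall (hF0 n))]
    refine ENNReal.ofReal_le_ofReal (le_of_eq_of_le ?_ (hfε n).le)
    refine (integral_integral_swap_of_hasCompactSupport (f := fun x g => f n (x * g) * h g) ?_
      (hasCompactSupport_mul_translate (hfc n) hhc)).symm
    have := hf n
    simp only [Function.uncurry_def]
    fun_prop
  have hmeas : Measurable fun g => ⨅ n, ENNReal.ofReal (F n g) :=
    Measurable.iInf fun n => (hFc n).measurable.ennreal_ofReal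
  have hzero : ∫⁻ g, ⨅ n, ENNReal.ofReal (F n g) ∂ρ = 0 := by
    refine le_antisymm (ge_of_tendsto' (x := Filter.atTop) (f := fun n : ℕ => ENNReal.ofReal (1 / ((n : ℝ) + 1))) ?_
      fun n => (lintegral_mono fun g => iInf_le _ n).trans (hFint n)) zero_le
    simpa using ENNReal.tendsto_ofReal tendsto_one_div_add_atTop_nhds_zero_nat
  filter_upwards [(lintegral_eq_zero_iff hmeas).1 hzero] with g hg
  by_cases hg0 : h g = 0
  · exact Or.inl hg0
  right
  have hgpos : 0 < h g := lt_of_le_of_ne (hh0 g) (Ne.symm hg0)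
  have hle : ∀ n, ENNReal.ofReal (h g) * m {x | x * g ∈ C} ≤ ENNReal.ofReal (F n g) := fun n => by
    have hc : Continuous fun x => f n (x * g) * h g := by
      have := hf n
      fun_prop
    have hs : HasCompactSupport fun x => f n (x * g) * h g :=
      ((hfc n).comp_homeomorph (Homeomorph.mulRight g)).mul_right
    rw [ofReal_integral_eq_lintegral_ofReal (hc.integrable_of_hasCompactSupport hs)
      (Filter.Eventually.of_forall fun x => mul_nonneg (hf0 n _) (hh0 g))]
    refine le_trans ?_ (mul_meas_ge_le_lintegral hc.measurable.ennreal_ofReal (ENNReal.ofReal (h g)))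
    gcongr with x
    intro hx
    exact ENNReal.ofReal_le_ofReal (le_mul_of_one_le_left (hh0 g) (hf1 n _ hx))
  have hprod : ENNReal.ofReal (h g) * m {x | x * g ∈ C} ≤ 0 := (le_iInf hle).trans hg.le
  simpa [hgpos.not_ge] using hprod

variable [T2Space G]

theorem isOpen_separatingSet (m : Measure G) (n : ℕ) : IsOpen (separatingSet m n) := by
  have : separatingSet m n = {1}ᶜ ∩
      ⋃ C ∈ {C | IsCompact C ∧ m Cᶜ < ((n : ENNReal) + 1)⁻¹}, (C⁻¹ * C)ᶜ := by
    ext g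
    simp [separatingSet, and_assoc]
  rw [this]
  exact isOpen_compl_singleton.inter
    (isOpen_biUnion fun C hC => (hC.1.inv.mul hC.1).isClosed.isOpen_compl)

variable [BorelSpace G]

/-- The set `A \ A g⁻¹` still carries `m`, and any compact `C` inside it satisfies `C ∩ C g = ∅`. -/
theorem mem_separatingSet_of_measure_translate_eq_zero {m : Measure G} [IsFiniteMeasure m]
    [m.InnerRegularCompactLTTop] {A : Set G} (hA : MeasurableSet A) (hmA : m Aᶜ = 0) {g : G}
    (hg : g ≠ 1) (h : m {x | x * g ∈ A} = 0) (n : ℕ) : g ∈ separatingSet m n := by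
  have hS : MeasurableSet (A \ {x | x * g ∈ A}) := hA.diff (measurable_mul_const g hA)
  obtain ⟨C, hCS, hC, hmC⟩ := hS.exists_isCompact_sdiff_lt (μ := m) (measure_ne_top _ _)
    (ε := ((n : ENNReal) + 1)⁻¹) (by simp)
  refine ⟨hg, C, hC, lt_of_le_of_lt ?_ hmC, ?_⟩
  · have hsub : Cᶜ ⊆ (Aᶜ ∪ {x | x * g ∈ A}) ∪ ((A \ {x | x * g ∈ A}) \ C) := by
      intro x hx
      by_cases h₁ : x ∈ A <;> by_cases h₂ : x * g ∈ A <;> simp_all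
    refine (measure_mono hsub).trans ((measure_union_le _ _).trans ?_)
    rw [measure_union_null hmA h, zero_add]
  · rintro ⟨c, hc, d, hd, rfl⟩
    refine (hCS (Set.mem_inv.1 hc)).2 ?_
    show c⁻¹ * (c * d) ∈ A
    rw [inv_mul_cancel_left]
    exact (hCS hd).1

theorem ae_mem_separatingSet {m ρ : Measure G} [IsFiniteMeasure m]
    [m.InnerRegularCompactLTTop] [IsFiniteMeasureOnCompacts ρ] {h : G → ℝ} (hh : Continuous h)
    (hhc : HasCompactSupport h) (hh0 : ∀ g, 0 ≤ h g) {A : Set G} (hA : MeasurableSet A)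
    (hmA : m Aᶜ = 0)
    (H : ∀ C ⊆ A, IsCompact C → ∀ ε > 0, ∃ f : G → ℝ, Continuous f ∧ HasCompactSupport f ∧
      (∀ x, 0 ≤ f x) ∧ (∀ x ∈ C, 1 ≤ f x) ∧ ∫ x, ∫ g, f (x * g) * h g ∂ρ ∂m < ε) :
    ∀ᵐ g ∂ρ, h g = 0 ∨ g = 1 ∨ ∀ n, g ∈ separatingSet m n := by
  have hC : ∀ n : ℕ, ∃ C ⊆ A, IsCompact C ∧ m (A \ C) < ((n : ENNReal) + 1)⁻¹ := fun n =>
    hA.exists_isCompact_sdiff_lt (measure_ne_top _ _) (by simp)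
  -- `A` is replaced by a σ-compact subset that still carries `m`, since `H` concerns compact sets
  -- only.
  choose C hCA hC hmC using hC
  have hm : m (⋃ n, C n)ᶜ = 0 := by
    have : m (A \ ⋃ n, C n) = 0 := by
      refine le_antisymm (ge_of_tendsto' (x := Filter.atTop) (f := fun n : ℕ => ((n : ENNReal) + 1)⁻¹) ?_ fun n =>
        (measure_mono (Set.sdiff_subset_sdiff_right (Set.subset_iUnion C n))).trans (hmC n).le) zero_le
      have := (Filter.tendsto_add_atTop_iff_nat 1).2 ENNReal.tendsto_inv_nat_nhds_zero
      simpa using this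
    refine measure_mono_null (t := Aᶜ ∪ A \ ⋃ n, C n) (fun x hx => ?_) (measure_union_null hmA this)
    by_cases hxA : x ∈ A
    exacts [Or.inr ⟨hxA, hx⟩, Or.inl hxA]
  have hae := ae_all_iff.2 fun n => ae_measure_translate_eq_zero hh hhc hh0 (H (C n) (hCA n) (hC n))
  filter_upwards [hae] with g hg
  by_cases hg0 : h g = 0
  · exact Or.inl hg0
  by_cases hg1 : g = 1
  · exact Or.inr (Or.inl hg1)
  refine Or.inr (Or.inr (mem_separatingSet_of_measure_translate_eq_zero
    (MeasurableSet.iUnion fun n => (hC n).measurableSet) hm hg1 ?_))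
  have : {x | x * g ∈ ⋃ n, C n} = ⋃ n, {x | x * g ∈ C n} := by ext; simp
  rw [this]
  exact measure_iUnion_null fun n => (hg n).resolve_left hg0

variable [LocallyCompactSpace G]

theorem dense_separatingSet {m l : Measure G} [IsFiniteMeasure m]
    [m.InnerRegularCompactLTTop] [l.IsHaarMeasure] [l.Regular] {A : Set G} (hA : MeasurableSet A)
    (hmA : m Aᶜ = 0) (hlA : l A = 0) (h1 : Dense ({1}ᶜ : Set G)) (n : ℕ) :
    Dense (separatingSet m n) := by
  refine dense_iff_inter_open.2 fun O hO hOne => ?_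
  obtain ⟨g₀, hg₀O, hg₀⟩ := h1.inter_open_nonempty O hO hOne
  have hO' : IsOpen (O ∩ {1}ᶜ) := hO.inter isOpen_compl_singleton
  obtain ⟨h, h1, h0, hhc, hh⟩ := exists_continuous_one_zero_of_isCompact
    (isCompact_singleton (x := g₀)) hO'.isClosed_compl
    (Set.disjoint_compl_right_iff_subset.2 (Set.singleton_subset_iff.2 ⟨hg₀O, hg₀⟩))
  have hae := ae_mem_separatingSet (m := m) (ρ := l) h.continuous hhc (fun g => (hh g).1) hA hmA
    (fun C hCA hC ε hε => by
      obtain ⟨f, hfc, hf, hf1, hfε⟩ := exists_bump_integral_lt (ν := l) hC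
        (measure_mono_null hCA hlA) (ε := ε / (m.real Set.univ + 1)) (by positivity)
      refine ⟨f, f.continuous, hfc, fun x => (hf x).1, fun x hx => (hf1 x hx).ge, ?_⟩
      -- Left invariance bounds the inner integral by `∫ f dl` uniformly in `x`; this is small
      -- because `C` is Haar null.
      have hle : ∀ x, ∫ g, f (x * g) * h g ∂l ≤ ∫ g, f g ∂l := fun x => by
        rw [← integral_mul_left_eq_self (μ := l) f x]
        have hfx : HasCompactSupport fun g => f (x * g) :=
          hfc.comp_homeomorph (Homeomorph.mulLeft x)
        refine integral_mono (Continuous.integrable_of_hasCompactSupport (by fun_prop) hfx.mul_right)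
          (Continuous.integrable_of_hasCompactSupport (by fun_prop) hfx) fun g => ?_
        exact mul_le_of_le_one_right (hf _).1 (hh g).2
      have h0 : 0 ≤ ∫ g, f g ∂l := integral_nonneg fun g => (hf g).1
      calc ∫ x, ∫ g, f (x * g) * h g ∂l ∂m ≤ ∫ x, ∫ g, f g ∂l ∂m :=
            integral_mono_of_nonneg (Filter.Eventually.of_forall fun x =>
              integral_nonneg fun g => mul_nonneg (hf _).1 (hh g).1) (integrable_const _)
              (Filter.Eventually.of_forall hle)
        _ = m.real Set.univ * ∫ g, f g ∂l := by simp
        _ ≤ (m.real Set.univ + 1) * ∫ g, f g ∂l := by gcongr; linarith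
        _ < ε := by rwa [lt_div_iff₀' (by positivity)] at hfε)
  have hpos : l {g | h g ≠ 0} ≠ 0 :=
    (isOpen_ne_fun h.continuous continuous_const).measure_ne_zero l ⟨g₀, by simp [h1 rfl]⟩
  obtain ⟨g, hg, hgs⟩ := (frequently_ae_mem_iff.2 hpos).and_eventually hae |>.exists
  have hgO : g ∈ O ∩ {1}ᶜ := by
    by_contra hgO
    exact hg (h0 hgO)
  exact ⟨g, hgO.1, (hgs.resolve_left hg).resolve_left hgO.2 n⟩

end Separation


/-! ### Averaging over a compact subgroup. -/

section CompactSubgroup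

variable {G : Type u} [Group G] [TopologicalSpace G] [IsTopologicalGroup G] [MeasurableSpace G]
  [BorelSpace G]

theorem haarOfCompact_univ (K : Subgroup G) (hK : IsCompact (K : Set G)) :
    haarOfCompact K hK Set.univ = 1 := by
  have : CompactSpace K := isCompact_iff_compactSpace.mp hK
  rw [haarOfCompact, Measure.map_apply measurable_subtype_coe MeasurableSet.univ]
  simpa using Measure.haarMeasure_self (K₀ := (⊤ : TopologicalSpace.PositiveCompacts K))

theorem ae_haarOfCompact_iff {K : Subgroup G} (hK : IsCompact (K : Set G))
    (hKm : MeasurableSet (K : Set G)) {P : G → Prop} : (∀ᵐ g ∂haarOfCompact K hK, P g) ↔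
      ∀ᵐ k : K ∂haveI : CompactSpace K := isCompact_iff_compactSpace.mp hK
        Measure.haarMeasure (⊤ : TopologicalSpace.PositiveCompacts K), P k :=
  (MeasurableEmbedding.subtype_coe hKm).ae_map_iff

/-- A right translate of Haar measure on the compact group `K` is again a Haar probability measure,
so uniqueness gives right invariance. -/
theorem integral_haarOfCompact_mul_right [T2Space G] {K : Subgroup G} (hK : IsCompact (K : Set G))
    {k : G} (hk : k ∈ K) (f : G → ℝ) :
    ∫ g, f (g * k) ∂haarOfCompact K hK = ∫ g, f g ∂haarOfCompact K hK := by
  have : CompactSpace K := isCompact_iff_compactSpace.mp hK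
  have he : MeasurableEmbedding (Subtype.val : K → G) :=
    MeasurableEmbedding.subtype_coe hK.measurableSet
  let l : Measure K := Measure.haarMeasure (⊤ : TopologicalSpace.PositiveCompacts K)
  have hl : IsProbabilityMeasure l := ⟨Measure.haarMeasure_self⟩
  have hl' : IsProbabilityMeasure (l.map (· * ⟨k, hk⟩)) :=
    Measure.isProbabilityMeasure_map (measurable_mul_const _).aemeasurable
  have heq : l.map (· * ⟨k, hk⟩) = l := Measure.isHaarMeasure_eq_of_isProbabilityMeasure _ _
  change ∫ g, f (g * k) ∂(l.map Subtype.val) = ∫ g, f g ∂(l.map Subtype.val)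
  rw [he.integral_map, he.integral_map]
  conv_rhs => rw [← heq, (measurableEmbedding_mulRight (⟨k, hk⟩ : K)).integral_map]
  rfl

/-- Averaging a finite measure over a compact subgroup: there is a finite regular measure
invariant under right translations by `K` that represents the functional
`f ↦ ∫∫ f (x k) dλ_K(k) dm(x)` on compactly supported functions. -/
theorem exists_regular_average [T2Space G] [LocallyCompactSpace G] (m : Measure G)
    [IsFiniteMeasure m] {K : Subgroup G} (hK : IsCompact (K : Set G)) {h : C(G, ℝ)}
    (hhc : HasCompactSupport h) (hh0 : ∀ g, 0 ≤ h g) (hh1 : ∀ k ∈ K, h k = 1) :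
    ∃ ν : Measure G, ν.Regular ∧ IsFiniteMeasure ν ∧
      (∀ k ∈ K, ν.map (· * k) = ν) ∧
      ∀ f : CompactlySupportedContinuousMap G ℝ,
        ∫ x, f x ∂ν = ∫ x, ∫ g, f (x * g) * h g ∂haarOfCompact K hK ∂m := by
  have hfin := isFiniteMeasure_haarOfCompact K hK
  let ρ := haarOfCompact K hK
  have hswap : ∀ f : CompactlySupportedContinuousMap G ℝ,
      ∫ x, ∫ g, f (x * g) * h g ∂ρ ∂m = ∫ g, ∫ x, f (x * g) * h g ∂m ∂ρ := fun f =>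
    integral_integral_swap_of_hasCompactSupport (f := fun x g => f (x * g) * h g)
      (by simp only [Function.uncurry_def]; fun_prop)
      (hasCompactSupport_mul_translate f.hasCompactSupport hhc)
  have hin : ∀ (f : CompactlySupportedContinuousMap G ℝ) (g : G),
      Integrable (fun x => f (x * g) * h g) m := fun f g =>
    Continuous.integrable_of_hasCompactSupport (by fun_prop)
      ((f.hasCompactSupport.comp_homeomorph (Homeomorph.mulRight g)).mul_right)
  have hout : ∀ f : CompactlySupportedContinuousMap G ℝ,
      Integrable (fun g => ∫ x, f (x * g) * h g ∂m) ρ := fun f =>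
    (continuous_integral_mul_translate f.continuous f.hasCompactSupport h.continuous
      hhc).integrable_of_hasCompactSupport (hhc.mono fun g hg hne => hg (by simp [hne]))
  -- The average is obtained from the Riesz–Markov theorem, which gives regularity directly; `h`
  -- equals `1` on `K` and only serves to make supports compact.
  let Λ : CompactlySupportedContinuousMap G ℝ →ₚ[ℝ] ℝ :=
    { toFun f := ∫ g, ∫ x, f (x * g) * h g ∂m ∂ρ
      map_add' f f' := by
        rw [← integral_add (hout f) (hout f')]
        refine integral_congr_ae (Filter.Eventually.of_forall fun g => ?_)
        simp only [CompactlySupportedContinuousMap.add_apply, add_mul]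
        exact integral_add (hin f g) (hin f' g)
      map_smul' c f := by
        simp [mul_assoc, integral_const_mul]
      monotone' f f' hff' := integral_mono (hout f) (hout f') fun g =>
        integral_mono (hin f g) (hin f' g) fun x => mul_le_mul_of_nonneg_right (hff' _) (hh0 g) }
  have hΛ : ∀ f : CompactlySupportedContinuousMap G ℝ,
      ∫ x, f x ∂(RealRMK.rieszMeasure Λ) = ∫ g, ∫ x, f (x * g) * h g ∂m ∂ρ :=
    RealRMK.integral_rieszMeasure Λ
  have hreg : (RealRMK.rieszMeasure Λ).Regular := inferInstance
  have hae : ∀ᵐ g ∂ρ, h g = 1 :=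
    (ae_haarOfCompact_iff hK hK.measurableSet).2 (Filter.Eventually.of_forall fun k => hh1 k k.2)
  refine ⟨RealRMK.rieszMeasure Λ, hreg, ⟨?_⟩, fun k hk => ?_, fun f => (hΛ f).trans (hswap f).symm⟩
  · refine lt_of_le_of_lt (b := ENNReal.ofReal (m.real Set.univ)) ?_ ENNReal.ofReal_lt_top
    rw [isOpen_univ.measure_eq_iSup_isCompact]
    refine iSup₂_le fun C _ => iSup_le fun hC => ?_
    obtain ⟨f, hf1, -, hfc, hf⟩ := exists_continuous_one_zero_of_isCompact hC isClosed_empty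
      (Set.disjoint_empty C)
    refine (RealRMK.rieszMeasure_le_of_eq_one Λ (f := ⟨f, hfc⟩) (fun x => (hf x).1) hC
      fun x hx => hf1 hx).trans (ENNReal.ofReal_le_ofReal ?_)
    have hle : ∫ g, ∫ x, f (x * g) * h g ∂m ∂ρ ≤ ∫ _, m.real Set.univ ∂ρ := by
      refine integral_mono_ae (hout ⟨f, hfc⟩) (integrable_const _) ?_
      filter_upwards [hae] with g hg
      have : ∫ x, f (x * g) * h g ∂m ≤ ∫ _, (1 : ℝ) ∂m :=
        integral_mono (hin ⟨f, hfc⟩ g) (integrable_const _) fun x => by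
          simpa [hg] using (hf (x * g)).2
      simpa using this
    have h1 : ρ.real Set.univ = 1 := by simp [Measure.real, ρ, haarOfCompact_univ]
    rw [integral_const, h1, one_smul] at hle
    exact hle
  · have hreg' : ((RealRMK.rieszMeasure Λ).map (· * k)).Regular :=
      Measure.Regular.map (Homeomorph.mulRight k)
    refine Measure.ext_of_integral_eq_on_compactlySupported fun f => ?_
    rw [(measurableEmbedding_mulRight k).integral_map]
    let fk : CompactlySupportedContinuousMap G ℝ :=
      ⟨⟨fun x => f (x * k), by fun_prop⟩,
        f.hasCompactSupport.comp_homeomorph (Homeomorph.mulRight k)⟩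
    refine (hΛ fk).trans (Eq.trans ?_ (hΛ f).symm)
    rw [← hswap, ← hswap]
    refine integral_congr_ae (Filter.Eventually.of_forall fun x => ?_)
    have hdrop : ∀ f' : G → ℝ, ∫ g, f' g * h g ∂ρ = ∫ g, f' g ∂ρ := fun f' => by
      refine integral_congr_ae ?_
      filter_upwards [hae] with g hg
      rw [hg, mul_one]
    change ∫ g, f (x * g * k) * h g ∂ρ = ∫ g, f (x * g) * h g ∂ρ
    rw [hdrop fun g => f (x * g * k), hdrop fun g => f (x * g)]
    simp only [mul_assoc]
    exact integral_haarOfCompact_mul_right hK hk fun g => f (x * g)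

/-- Bump functions of small `ν`-integral feed the Fubini argument for `λ_K`. A suitable `k ≠ 1`
exists because the nonempty open set `K \ {1}` has positive Haar measure in `K`. -/
theorem exists_mem_separatingSet [T2Space G] [LocallyCompactSpace G] {m ν : Measure G}
    [IsFiniteMeasure m] [m.InnerRegularCompactLTTop] [ν.Regular] {K : Subgroup G}
    (hK : IsCompact (K : Set G)) (hK1 : K ≠ ⊥) {h : C(G, ℝ)}
    (hhc : HasCompactSupport h) (hh0 : ∀ g, 0 ≤ h g) (hh1 : ∀ k ∈ K, h k = 1)
    (hν : ∀ f : CompactlySupportedContinuousMap G ℝ,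
        ∫ x, f x ∂ν = ∫ x, ∫ g, f (x * g) * h g ∂haarOfCompact K hK ∂m)
    {A : Set G} (hA : MeasurableSet A) (hmA : m Aᶜ = 0) (hνA : ν A = 0) :
    ∃ k ∈ K, ∀ n, k ∈ separatingSet m n := by
  have hfin := isFiniteMeasure_haarOfCompact K hK
  have hae := ae_mem_separatingSet (m := m) (ρ := haarOfCompact K hK) h.continuous hhc hh0 hA hmA
    fun C hCA hC ε hε => by
      obtain ⟨f, hfc, hf, hf1, hfε⟩ := exists_bump_integral_lt (ν := ν) hC
        (measure_mono_null hCA hνA) hε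
      exact ⟨f, f.continuous, hfc, fun x => (hf x).1, fun x hx => (hf1 x hx).ge,
        (hν ⟨f, hfc⟩).symm.trans_lt hfε⟩
  have : CompactSpace K := isCompact_iff_compactSpace.mp hK
  rw [ae_haarOfCompact_iff hK hK.measurableSet] at hae
  have hne : ({1}ᶜ : Set K).Nonempty := by
    obtain ⟨k, hk, hk1⟩ := K.bot_or_exists_ne_one.resolve_left hK1
    exact ⟨⟨k, hk⟩, fun h => hk1 (congrArg Subtype.val h)⟩
  have hpos := isOpen_compl_singleton.measure_ne_zero
    (Measure.haarMeasure (⊤ : TopologicalSpace.PositiveCompacts K)) hne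
  obtain ⟨k, hk, hks⟩ := (frequently_ae_mem_iff.2 hpos).and_eventually hae |>.exists
  refine ⟨k, k.2, (hks.resolve_left ?_).resolve_left fun h => hk (Subtype.ext h)⟩
  rw [hh1 k k.2]
  exact one_ne_zero

end CompactSubgroup

/-! ### Transfer to `𝕜`-valued measures and conclusion. -/

section VectorMeasures

variable (𝕜 : Type*) [RCLike 𝕜] {G : Type u} [MeasurableSpace G]

/-- A finite positive measure as a `𝕜`-valued measure. -/
def ofMeasure (ν : Measure G) [IsFiniteMeasure ν] : VectorMeasure G 𝕜 :=
  ν.toSignedMeasure.mapRange (algebraMap ℝ 𝕜).toAddMonoidHom (RCLike.continuous_ofReal (K := 𝕜))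

theorem ofMeasure_apply (ν : Measure G) [IsFiniteMeasure ν] {B : Set G} (hB : MeasurableSet B) :
    ofMeasure 𝕜 ν B = (ν.real B : 𝕜) := by
  simp [ofMeasure, hB]

theorem variation_ofMeasure (ν : Measure G) [IsFiniteMeasure ν] :
    (ofMeasure 𝕜 ν).variation = ν := by
  have key : ∀ s, MeasurableSet s → ‖ofMeasure 𝕜 ν s‖ₑ = ν s := fun s hs => by
    rw [ofMeasure_apply 𝕜 ν hs, ← ofReal_norm, RCLike.norm_ofReal, abs_of_nonneg measureReal_nonneg,
      ofReal_measureReal]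
  apply le_antisymm
  · exact VectorMeasure.variation_le_of_forall_enorm_le fun s hs => (key s hs).le
  · exact Measure.le_iff.2 fun s hs =>
      (key s hs).ge.trans (VectorMeasure.enorm_measure_le_variation _ _)

variable [Group G] [TopologicalSpace G] [IsTopologicalGroup G] [BorelSpace G] [T2Space G]

/-- By invariance `y ↦ ν (B y⁻¹)` is constant on `K`, and `λ_K` has total mass `1`. -/
theorem ofMeasure_mem_cosetMeasures (ν : Measure G) [IsFiniteMeasure ν] [hr : ν.Regular]
    {K : Subgroup G} (hK : IsCompact (K : Set G)) (hinv : ∀ k ∈ K, ν.map (· * k) = ν) :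
    ofMeasure 𝕜 ν ∈ cosetMeasures 𝕜 K hK := by
  have hfin := isFiniteMeasure_haarOfCompact K hK
  have hvar : (haarVec 𝕜 K hK).variation = haarOfCompact K hK :=
    variation_ofMeasure 𝕜 (haarOfCompact K hK)
  have hvfin : IsFiniteMeasure (haarVec 𝕜 K hK).variation := by rwa [hvar]
  refine ⟨?_, (IsConvolution.conv_eq fun B hB => ?_).symm⟩
  · rw [radonMeasures, Set.mem_ofPred_eq, variation_ofMeasure]
    exact ⟨inferInstance, hr⟩
  · have hae : (fun y => ofMeasure 𝕜 ν ((fun x => x * y) ⁻¹' B)) =ᵐ[(haarVec 𝕜 K hK).variation]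
        fun _ => ofMeasure 𝕜 ν B := by
      rw [hvar]
      refine (ae_haarOfCompact_iff hK hK.measurableSet).2 (Filter.Eventually.of_forall fun k => ?_)
      have hm := measurable_mul_const (k : G)
      simp only [ofMeasure_apply 𝕜 ν hB, ofMeasure_apply 𝕜 ν (hm hB)]
      conv_rhs => rw [← hinv k k.2]
      rw [Measure.real, Measure.real, Measure.map_apply hm hB]
    rw [VectorMeasure.integral_congr_ae hae, VectorMeasure.integral_const]
    have h1 : haarVec 𝕜 K hK Set.univ = 1 :=
      (ofMeasure_apply 𝕜 (haarOfCompact K hK) MeasurableSet.univ).trans (by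
        simp [Measure.real, haarOfCompact_univ])
    simp [h1]

variable {𝕜}

theorem mutuallySingular_of_mul_inv_mem {μ : VectorMeasure G 𝕜} {p q : G}
    (h : ∀ n, p * q⁻¹ ∈ separatingSet μ.variation n) :
    VectorMeasure.MutuallySingular (conv μ (pointMass 𝕜 p)) (conv μ (pointMass 𝕜 q)) := by
  obtain ⟨A, hA, hmA, hdis⟩ := exists_disjoint_translates_of_mem_separatingSet h
  have hzero := (VectorMeasure.variation_apply_eq_zero hA.compl).1 hmA
  have hp := measurable_mul_const p
  have hq := measurable_mul_const q
  rw [conv_pointMass, conv_pointMass]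
  refine VectorMeasure.MutuallySingular.mk ((fun x => x * p⁻¹) ⁻¹' A)ᶜ
    (measurable_mul_const p⁻¹ hA).compl (fun t ht htm => ?_) fun t ht htm => ?_
  · rw [VectorMeasure.map_apply _ hp htm]
    refine hzero _ (fun x hx hxA => ht hx ?_) (hp htm)
    simpa using hxA
  · rw [VectorMeasure.map_apply _ hq htm]
    refine hzero _ (fun x hx hxA => ?_) (hq htm)
    have hxt : x * q * p⁻¹ ∈ A := by simpa using ht hx
    exact hdis _ hxt _ hxA (by simp)

theorem exists_separated_family [LocallyCompactSpace G] {τ : Cardinal.{u}} (hτ : ℵ₀ ≤ τ)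
    (hτG : τ ≤ groupCharacter G) {μ : VectorMeasure G 𝕜} (hμ : μ ∈ stronglySingular 𝕜 G τ) :
    ∃ (X : Type u) (p : X → G), #X = 2 ^ τ ∧
      ∀ x y, x ≠ y → ∀ n, p x * (p y)⁻¹ ∈ separatingSet μ.variation n := by
  obtain ⟨⟨⟨hfin, hreg⟩, s, hs, hμs, hhs⟩, -, hsing⟩ := hμ
  rcases hτ.eq_or_lt with rfl | hτ'
  -- A discrete group has character at most `1`, so `ℵ₀ ≤ χ(G)` rules it out.
  · have h1 : Dense ({1}ᶜ : Set G) := by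
      refine dense_compl_singleton_iff_not_open.2 fun hopen => ?_
      have hb : (𝓝 (1 : G)).HasBasis (fun U => U ∈ ({{1}} : Set (Set G))) id := by
        rw [(isOpen_singleton_iff_nhds_eq_pure 1).1 hopen]
        exact ⟨fun U => by simp⟩
      have hle : groupCharacter G ≤ 1 := characterAt_le (mk_singleton _).le hb
      exact absurd (hτG.trans hle) one_lt_aleph0.not_ge
    have hhaar : Measure.haar (G := G) sᶜ = 0 := by
      have := hhs sᶜ subset_rfl
      rwa [Measure.toENNRealVectorMeasure_apply_measurable hs.compl] at this
    have hms : μ.variation s = 0 :=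
      (VectorMeasure.variation_apply_eq_zero hs).2 fun t ht _ => hμs t ht
    obtain ⟨p, hp⟩ := exists_separated_scheme (isOpen_separatingSet μ.variation)
      (dense_separatingSet hs.compl (by rwa [compl_compl]) hhaar h1)
      (separatingSet_antitone μ.variation)
    exact ⟨ULift (ℕ → Bool), fun x => p x.down, by simp,
      fun x y hxy => hp _ _ fun h => hxy (ULift.down_injective h)⟩
  · obtain ⟨p, hp⟩ := exists_separated_tree hτ' (isOpen_separatingSet μ.variation)
      (inv_separatingSet μ.variation) fun K hK κ hκ hκτ hKκ => by
        have hK1 : K ≠ ⊥ := by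
          rintro rfl
          exact (hτG.trans (hKκ.groupCharacter_le hκ)).not_gt hκτ
        obtain ⟨h, hh1, -, hhc, hh⟩ := exists_continuous_one_zero_of_isCompact hK isClosed_empty
          (Set.disjoint_empty (K : Set G))
        obtain ⟨ν, hνr, hνf, hνK, hν⟩ := exists_regular_average μ.variation hK hhc
          (fun g => (hh g).1) fun k hk => hh1 hk
        -- The average `ν` has character at most `κ < τ`, so strong singularity applies to it.
        obtain ⟨t, ht, hμt, hνt⟩ := hsing κ hκ hκτ (ofMeasure 𝕜 ν)
          ⟨K, hK, hKκ.cosetCharacter_le hκ hK, ofMeasure_mem_cosetMeasures 𝕜 ν hK hνK⟩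
        have hmt : μ.variation t = 0 :=
          (VectorMeasure.variation_apply_eq_zero ht).2 fun s hs _ => hμt s hs
        have hnt : ν tᶜ = 0 := by
          rw [← variation_ofMeasure 𝕜 ν]
          exact (VectorMeasure.variation_apply_eq_zero ht.compl).2 fun s hs _ => hνt s hs
        exact exists_mem_separatingSet hK hK1 hhc (fun g => (hh g).1) (fun k hk => hh1 hk) hν
          ht.compl (by rwa [compl_compl]) hnt
    exact ⟨_, p, by simp, hp⟩

end VectorMeasures

end GroupMeasure

end

theorem mainTheorem7 {𝕜 : Type*} [RCLike 𝕜]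
    {G : Type u} [Group G] [TopologicalSpace G] [IsTopologicalGroup G] [T2Space G]
    [LocallyCompactSpace G] [MeasurableSpace G] [BorelSpace G]
    (τ : Cardinal.{u}) (hτ : ℵ₀ ≤ τ) (hτG : τ ≤ GroupMeasure.groupCharacter G)
    (μ : VectorMeasure G 𝕜) (hμ : μ ∈ GroupMeasure.stronglySingular 𝕜 G τ) :
    (∃ P : Set G, #P = 2 ^ τ ∧ ∀ p ∈ P, ∀ p' ∈ P, p ≠ p' →
      VectorMeasure.MutuallySingular
        (GroupMeasure.conv μ (GroupMeasure.pointMass 𝕜 p))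
        (GroupMeasure.conv μ (GroupMeasure.pointMass 𝕜 p'))) ∧
    GroupMeasure.IsThin (2 ^ τ) μ := by
  obtain ⟨X, p, hX, hp⟩ := GroupMeasure.exists_separated_family hτ hτG hμ
  -- Separating sets omit `1`, so distinct indices give distinct points.
  have hinj : Function.Injective p := fun x y hxy => by
    by_contra hne
    exact (hp x y hne 0).1 (by rw [hxy, mul_inv_cancel])
  have hthin : GroupMeasure.IsThin (2 ^ τ) μ := by
    refine ⟨Set.range p, (mk_range_eq p hinj).trans hX, ?_⟩
    rintro _ ⟨x, rfl⟩ _ ⟨y, rfl⟩ hxy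
    exact GroupMeasure.mutuallySingular_of_mul_inv_mem (hp x y fun h => hxy (congrArg p h))
  exact ⟨hthin, hthin⟩
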